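/- A cubic graph is a finite graph without loops, multiple edges allowed, in which every vertex is incident to exactly three edges; for a vertex $v$ of $G$ let $\partial_G(v)$ be the set of edges of $G$ incident to $v$. For cubic graphs $G$ and $H$ write $H \prec G$ if there is a map $f : E(G) \to E(H)$ such that distinct edges of $G$ sharing a vertex have distinct images, and for every vertex $x$ of $G$ there is a vertex $y$ of $H$ with $f(\partial_G(x)) = \partial_H(y)$. Let $P$ be the Petersen graph. **Theorem.** If $G$ is a connected bridgeless cubic graph with $G \prec P$, then $G$ is isomorphic to $P$. -/

import Mathlib

namespace Graph

variable {α β γ δ : Type*}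

/-- A (loopless) multigraph is cubic if it has no loops and every vertex is incident to exactly
three edges. -/
structure IsCubic (G : Graph α β) : Prop where
  loopless : G.Loopless
  ncard_incidenceSet : ∀ x ∈ G.vertexSet, (G.incidenceSet x).ncard = 3

/-- `G.Reachable x y`: the vertices `x` and `y` are joined by a walk in `G`
(possibly of length zero). -/
def Reachable (G : Graph α β) (x y : α) : Prop :=
  x ∈ G.vertexSet ∧ Relation.ReflTransGen G.Adj x y

/-- A multigraph is connected if it has a vertex and any two of its vertices are joined by
a walk. -/
structure IsConnected (G : Graph α β) : Prop where
  nonempty : G.vertexSet.Nonempty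
  reachable : ∀ x ∈ G.vertexSet, ∀ y ∈ G.vertexSet, G.Reachable x y

/-- An edge `e` is a bridge of `G` if its ends lie in different components of `G - e`. -/
def IsBridge (G : Graph α β) (e : β) : Prop :=
  ∃ x y, G.IsLink e x y ∧ ¬ (G.deleteEdges {e}).Reachable x y

/-- A multigraph is bridgeless if none of its edges is a bridge. -/
def IsBridgeless (G : Graph α β) : Prop :=
  ∀ e ∈ G.edgeSet, ¬ G.IsBridge e

/-- `f` is an `H`-coloring of `G`: a proper coloring of the edges of `G` by edges of `H` such that
for every vertex `x` of `G` the set of colors at `x` is the set of all edges of `H` incident to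
some vertex `y` of `H`. -/
structure IsColoring (H : Graph α β) (G : Graph γ δ) (f : G.edgeSet → H.edgeSet) : Prop where
  proper : ∀ e e' : G.edgeSet, e ≠ e' → (∃ x, G.Inc e x ∧ G.Inc e' x) → f e ≠ f e'
  image_eq : ∀ x ∈ G.vertexSet, ∃ y ∈ H.vertexSet,
    f '' {e : G.edgeSet | G.Inc e x} = {c : H.edgeSet | H.Inc c y}

/-- `H.Prec G` is the relation `H ≺ G`: the graph `G` admits an `H`-coloring. -/
def Prec (H : Graph α β) (G : Graph γ δ) : Prop :=
  ∃ f : G.edgeSet → H.edgeSet, IsColoring H G f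

/-- Two multigraphs are isomorphic if there are bijections between their vertices and between
their edges that preserve the ends of every edge. -/
def IsIsomorphic (G : Graph α β) (H : Graph γ δ) : Prop :=
  ∃ (φ : G.vertexSet ≃ H.vertexSet) (ψ : G.edgeSet ≃ H.edgeSet),
    ∀ (e : G.edgeSet) (x y : G.vertexSet), G.IsLink e x y ↔ H.IsLink (ψ e) (φ x) (φ y)

/-- Adjacency in the Petersen graph: the vertices `Sum.inl i` form the outer pentagon, the
vertices `Sum.inr i` form the inner pentagram, and `Sum.inl i` is joined to `Sum.inr i`. -/
def petersenAdj : ZMod 5 ⊕ ZMod 5 → ZMod 5 ⊕ ZMod 5 → Prop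
  | Sum.inl i, Sum.inl j => j = i + 1 ∨ i = j + 1
  | Sum.inr i, Sum.inr j => j = i + 2 ∨ i = j + 2
  | Sum.inl i, Sum.inr j => i = j
  | Sum.inr i, Sum.inl j => i = j

instance : DecidableRel petersenAdj
  | Sum.inl i, Sum.inl j => inferInstanceAs (Decidable (j = i + 1 ∨ i = j + 1))
  | Sum.inr i, Sum.inr j => inferInstanceAs (Decidable (j = i + 2 ∨ i = j + 2))
  | Sum.inl i, Sum.inr j => inferInstanceAs (Decidable (i = j))
  | Sum.inr i, Sum.inl j => inferInstanceAs (Decidable (i = j))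

/-- The Petersen graph, as a simple graph. -/
def petersenSimple : SimpleGraph (ZMod 5 ⊕ ZMod 5) where
  Adj := petersenAdj
  symm := ⟨by decide⟩
  loopless := ⟨by decide⟩

/-- The Petersen graph, as a multigraph. -/
def petersen : Graph (ZMod 5 ⊕ ZMod 5) (Sym2 (ZMod 5 ⊕ ZMod 5)) :=
  ofSimpleGraph petersenSimple

end Graph

/-!
A `G`-coloring of the Petersen graph `P` maps the edges at each vertex `x` of `P` bijectively to the
edges at some vertex `φ x` of `G`, so perfect matchings of `G` pull back to perfect matchings of `P`.
Two facts about matchings carry the proof. Since `G` is cubic and bridgeless, each of its edges lies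
in a perfect matching (`IsCubic.exists_isPerfectMatching`, from Tutte's theorem, since odd cuts have
at least three edges). And every edge of `P` outside a perfect matching lies on a 5-cycle outside
that matching (`exists_fiveCycle`). Hence, for every perfect matching `M` of `G`, each edge of `P`
with color outside `M` lies on a 5-cycle whose colors form a closed walk of length five in the
2-regular graph `G - M`.

If both ends of an edge of `P` had the same image, such a walk would have only three distinct edges,
a triangle (`IsPetersenColoring.exists_triangle`); comparing the triangles for suitable choices
of `M` excludes this (`IsPetersenColoring.map_ne`). So `φ` preserves adjacency. If `φ` identified two
vertices, then, `P` having diameter two, `G` would have a pair of parallel edges, which form a 2-cycle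
of `G - M` for a suitable `M`; but a closed walk in a 2-cycle has even length
(`IsPetersenColoring.injective`). So `φ` is injective, and it is surjective because `G` is connected
and `φ` maps the edges at each vertex onto those at its image.
-/

namespace Graph

/-! ### Perfect matchings of bridgeless cubic graphs -/

/-- A perfect matching of a multigraph, as a set of edges that contains exactly one edge at each
vertex. -/
structure IsPerfectMatching {α β : Type*} (G : Graph α β) (M : Set β) : Prop where
  subset : M ⊆ G.edgeSet
  existsUnique : ∀ x ∈ G.vertexSet, ∃! e, e ∈ M ∧ G.Inc e x

/-- The set of edges of `G` with exactly one end in `K`. -/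
def cut {α β : Type*} (G : Graph α β) (K : Set α) : Set β :=
  {e | ∃ x y, G.IsLink e x y ∧ x ∈ K ∧ y ∉ K}

section
variable {α β : Type*} {G : Graph α β}

lemma IsCubic.finite_incidenceSet (hG : G.IsCubic) {x : α} (hx : x ∈ G.vertexSet) :
    (G.incidenceSet x).Finite :=
  Set.finite_of_ncard_ne_zero (by rw [hG.ncard_incidenceSet x hx]; norm_num)

lemma IsCubic.finite_edgeSet (hG : G.IsCubic) (hfin : G.vertexSet.Finite) : G.edgeSet.Finite := by
  refine (hfin.biUnion fun x hx ↦ hG.finite_incidenceSet hx).subset fun e he ↦ ?_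
  obtain ⟨x, y, h⟩ := exists_isLink_of_mem_edgeSet he
  exact Set.mem_biUnion h.left_mem h.inc_left

/-- An edge leaving `K` alone would be a bridge. -/
lemma IsBridgeless.cut_ne_singleton (hG : G.IsBridgeless) (K : Set α) (e : β) :
    G.cut K ≠ {e} := by
  intro h
  have he : e ∈ G.cut K := by simp [h]
  obtain ⟨x, y, hxy, hx, hy⟩ := he
  refine hG e hxy.edge_mem ⟨x, y, hxy, fun hr ↦ hy ?_⟩
  have key : ∀ z, Relation.ReflTransGen (G.deleteEdges {e}).Adj x z → z ∈ K := by
    intro z hz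
    induction hz with
    | refl => exact hx
    | tail _ hab ih =>
      obtain ⟨e', he'⟩ := hab
      rw [deleteEdges_isLink] at he'
      by_contra hc
      have : e' ∈ G.cut K := ⟨_, _, he'.1, ih, hc⟩
      rw [h] at this
      exact he'.2 this
  exact key y hr.2

open Classical in
/-- Counting incidences of edges with vertices of `K` gives `3 * |K|`, and modulo two only the
edges of the cut contribute. -/
lemma IsCubic.odd_ncard_cut (hG : G.IsCubic) (hfin : G.vertexSet.Finite) (K : Finset α)
    (hK : (K : Set α) ⊆ G.vertexSet) : Odd (G.cut K).ncard ↔ Odd K.card := by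
  have hE := hG.finite_edgeSet hfin
  have hl := hG.loopless
  have h1 : ∑ x ∈ K, (hE.toFinset.filter fun e ↦ G.Inc e x).card = 3 * K.card := by
    rw [Finset.sum_congr rfl (g := fun _ ↦ 3), Finset.sum_const, smul_eq_mul, mul_comm]
    intro x hx
    rw [← hG.ncard_incidenceSet x (hK hx), ← Set.ncard_coe_finset]
    congr 1
    ext e
    simpa using fun h : G.Inc e x ↦ h.edge_mem
  have h2 : ∑ e ∈ hE.toFinset, (K.filter fun x ↦ G.Inc e x).card = 3 * K.card := by
    rw [← h1]
    simp only [Finset.card_filter]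
    exact Finset.sum_comm
  have h3 : Odd (3 * K.card) ↔ Odd K.card := by
    rw [Nat.odd_mul]; simp [show Odd 3 by decide]
  rw [← h3, ← h2, Finset.odd_sum_iff_odd_card_odd, ← Set.ncard_coe_finset]
  congr! 2
  ext e
  simp only [Finset.coe_filter, Set.Finite.mem_toFinset, Set.mem_ofPred_eq, cut]
  constructor
  · rintro ⟨x, y, hxy, hx, hy⟩
    refine ⟨hxy.edge_mem, ?_⟩
    rw [show K.filter (fun x ↦ G.Inc e x) = {x} by
      ext z
      simp only [Finset.mem_filter, Finset.mem_singleton]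
      refine ⟨fun ⟨hz, hi⟩ ↦ ?_, ?_⟩
      · rcases hi.eq_or_eq_of_isLink hxy with rfl | rfl
        · rfl
        · exact absurd hz hy
      · rintro rfl
        exact ⟨hx, hxy.inc_left⟩]
    simp
  · rintro ⟨he, hodd⟩
    obtain ⟨x, y, hxy⟩ := exists_isLink_of_mem_edgeSet he
    by_cases hx : x ∈ K <;> by_cases hy : y ∈ K
    · exfalso
      rw [show K.filter (fun x ↦ G.Inc e x) = {x, y} by
        ext z
        simp only [Finset.mem_filter, Finset.mem_singleton, Finset.mem_insert]
        refine ⟨fun ⟨hz, hi⟩ ↦ hi.eq_or_eq_of_isLink hxy, ?_⟩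
        rintro (rfl | rfl)
        · exact ⟨hx, hxy.inc_left⟩
        · exact ⟨hy, hxy.inc_right⟩, Finset.card_pair hxy.ne] at hodd
      exact absurd hodd (by decide)
    · exact ⟨x, y, hxy, hx, hy⟩
    · exact ⟨y, x, hxy.symm, hy, hx⟩
    · exfalso
      rw [show K.filter (fun x ↦ G.Inc e x) = ∅ by
        ext z
        simp only [Finset.mem_filter, Finset.notMem_empty, iff_false]
        rintro ⟨hz, hi⟩
        rcases hi.eq_or_eq_of_isLink hxy with rfl | rfl
        · exact hx hz
        · exact hy hz] at hodd
      simp at hodd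

lemma IsCubic.three_le_ncard_cut (hG : G.IsCubic) (hfin : G.vertexSet.Finite)
    (hb : G.IsBridgeless) (K : Finset α) (hK : (K : Set α) ⊆ G.vertexSet) (hodd : Odd K.card) :
    3 ≤ (G.cut K).ncard := by
  have h := (hG.odd_ncard_cut hfin K hK).2 hodd
  have h1 : (G.cut K).ncard ≠ 1 := by
    rw [Ne, Set.ncard_eq_one]
    rintro ⟨e, he⟩
    exact hb.cut_ne_singleton _ e he
  obtain ⟨k, hk⟩ := h
  omega

lemma IsCubic.even_ncard_vertexSet (hG : G.IsCubic) (hfin : G.vertexSet.Finite) :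
    Even G.vertexSet.ncard := by
  have h := hG.odd_ncard_cut hfin hfin.toFinset (by simp)
  have h0 : G.cut hfin.toFinset = ∅ := by
    ext e
    simp only [cut, Set.Finite.coe_toFinset, Set.mem_ofPred_eq, Set.mem_empty_iff_false, iff_false]
    rintro ⟨x, y, hxy, -, hy⟩
    exact hy hxy.right_mem
  rw [h0, Set.ncard_empty] at h
  rw [Set.ncard_eq_toFinset_card _ hfin, ← Nat.not_odd_iff_even, ← h]
  decide

open Classical in
/-- Each odd part `K i` sends at least three edges to `S`, while `S` receives at most
`3 * |S| - 2` edges because `b` is inside `S`. -/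
lemma IsCubic.three_mul_card_add_two_le (hG : G.IsCubic) (hfin : G.vertexSet.Finite)
    (hb : G.IsBridgeless) {ι : Type*} [Fintype ι] (S : Finset α) (hS : (S : Set α) ⊆ G.vertexSet)
    {b : β} {w w' : α} (hbl : G.IsLink b w w') (hw : w ∈ S) (hw' : w' ∈ S)
    (K : ι → Finset α) (hK : ∀ i, (K i : Set α) ⊆ G.vertexSet)
    (hodd : ∀ i, Odd (K i).card) (hKS : ∀ i, ∀ x ∈ K i, x ∉ S)
    (hdisj : ∀ i j, ∀ x ∈ K i, x ∈ K j → i = j)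
    (hcl : ∀ i e x y, G.IsLink e x y → x ∈ K i → y ∉ S → y ∈ K i) :
    3 * Fintype.card ι + 2 ≤ 3 * S.card := by
  have hE := hG.finite_edgeSet hfin
  have hl := hG.loopless
  have hcutE : ∀ i, G.cut (K i) ⊆ G.edgeSet := by
    rintro i e ⟨x, y, hxy, -, -⟩
    exact hxy.edge_mem
  have hcfin : ∀ i, (G.cut (K i)).Finite := fun i ↦ hE.subset (hcutE i)
  let C : ι → Finset β := fun i ↦ (hcfin i).toFinset
  have hC : ∀ i e, e ∈ C i → ∃ x y, G.IsLink e x y ∧ x ∈ K i ∧ y ∈ S := by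
    intro i e he
    obtain ⟨x, y, hxy, hx, hy⟩ := (hcfin i).mem_toFinset.1 he
    exact ⟨x, y, hxy, hx, by_contra fun h ↦ hy (hcl i e x y hxy hx h)⟩
  have h3 : ∀ i, 3 ≤ (C i).card := by
    intro i
    have := hG.three_le_ncard_cut hfin hb (K i) (hK i) (hodd i)
    rwa [Set.ncard_eq_toFinset_card _ (hcfin i)] at this
  have hCdisj : ∀ i ∈ Finset.univ, ∀ j ∈ Finset.univ, i ≠ j → Disjoint (C i) (C j) := by
    intro i _ j _ hij
    rw [Finset.disjoint_left]
    intro e hei hej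
    obtain ⟨x, y, hxy, hx, hy⟩ := hC i e hei
    obtain ⟨x', y', hxy', hx', hy'⟩ := hC j e hej
    rcases hxy.left_eq_or_eq hxy' with rfl | rfl
    · exact hij (hdisj i j _ hx hx')
    · exact hKS i _ hx hy'
  let D : α → Finset β := fun x ↦ hE.toFinset.filter fun e ↦ G.Inc e x
  have hD : ∀ x ∈ S, (D x).card = 3 := by
    intro x hx
    rw [← hG.ncard_incidenceSet x (hS hx), ← Set.ncard_coe_finset]
    congr 1
    ext e
    simpa [D] using fun h : G.Inc e x ↦ h.edge_mem
  have hsub : Finset.univ.biUnion C ⊆ S.biUnion fun x ↦ (D x).erase b := by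
    intro e he
    obtain ⟨i, -, hi⟩ := Finset.mem_biUnion.1 he
    obtain ⟨x, y, hxy, hx, hy⟩ := hC i e hi
    refine Finset.mem_biUnion.2 ⟨y, hy, Finset.mem_erase.2 ⟨?_, ?_⟩⟩
    · rintro rfl
      rcases hxy.left_eq_or_eq hbl with rfl | rfl
      · exact hKS i _ hx hw
      · exact hKS i _ hx hw'
    · simp [D, hxy.edge_mem, hxy.inc_right]
  have hle := Finset.card_le_card hsub
  rw [Finset.card_biUnion hCdisj] at hle
  have hle2 := hle.trans Finset.card_biUnion_le
  have hsum1 : 3 * Fintype.card ι ≤ ∑ i, (C i).card := by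
    rw [mul_comm, ← smul_eq_mul, ← Finset.card_univ]
    exact Finset.card_nsmul_le_sum _ _ _ fun i _ ↦ h3 i
  have hsplit : ∑ x ∈ S, ((D x).erase b).card + ∑ x ∈ S, (if b ∈ D x then 1 else 0) =
      3 * S.card := by
    rw [← Finset.sum_add_distrib, Finset.sum_congr rfl (g := fun _ ↦ 3), Finset.sum_const,
      smul_eq_mul, mul_comm]
    intro x hx
    rw [Finset.card_erase_eq_ite, hD x hx]
    split_ifs <;> rfl
  have htwo : 2 ≤ ∑ x ∈ S, (if b ∈ D x then 1 else 0) := by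
    rw [← Finset.card_filter, ← Finset.card_pair hbl.ne]
    refine Finset.card_le_card ?_
    intro x hx
    rcases Finset.mem_insert.1 hx with rfl | hx
    · simp [D, hbl.edge_mem, hbl.inc_left, hw]
    · rw [Finset.mem_singleton] at hx
      subst hx
      simp [D, hbl.edge_mem, hbl.inc_right, hw']
  omega

/-- A perfect matching of `G` minus the ends of `b` extends by `b`. By Tutte's theorem such a
matching is missing only if some `U` leaves more than `|U|`, hence by parity at least `|U| + 2`,
odd components, which contradicts the count of edges between these and `U` with the ends of `b`. -/
theorem IsCubic.exists_isPerfectMatching (hG : G.IsCubic) (hfin : G.vertexSet.Finite)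
    (hb : G.IsBridgeless) {b : β} (hbE : b ∈ G.edgeSet) :
    ∃ M, G.IsPerfectMatching M ∧ b ∈ M := by
  classical
  have hl := hG.loopless
  obtain ⟨w, w', hbl⟩ := exists_isLink_of_mem_edgeSet hbE
  let W := {x : α // x ∈ G.vertexSet ∧ x ≠ w ∧ x ≠ w'}
  have hWfin : Finite W := (hfin.subset (fun x hx ↦ hx.1) :
    {x | x ∈ G.vertexSet ∧ x ≠ w ∧ x ≠ w'}.Finite)
  let H : SimpleGraph W :=
    { Adj := fun x y ↦ G.Adj x y
      symm := ⟨fun x y h ↦ h.symm⟩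
      loopless := ⟨fun x h ↦ G.not_adj_self _ h⟩ }
  have hcardW : Nat.card W + 2 = G.vertexSet.ncard := by
    have h1 : Nat.card W = (G.vertexSet \ {w, w'}).ncard := by
      rw [← Nat.card_coe_set_eq]
      refine Nat.card_congr (Equiv.subtypeEquivRight fun x ↦ ?_)
      simp
    rw [h1, ← Set.ncard_pair hbl.ne]
    refine Set.ncard_sdiff_add_ncard_of_subset ?_ hfin
    rintro x (rfl | rfl)
    exacts [hbl.left_mem, hbl.right_mem]
  obtain ⟨N, hN⟩ : ∃ N : H.Subgraph, N.IsPerfectMatching := by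
    rw [SimpleGraph.tutte]
    intro U hU
    let A := (⊤ : H.Subgraph).deleteVerts U
    let val2 : A.verts → α := fun x ↦ x.1.1
    have hval2 : Function.Injective val2 := fun x y h ↦ Subtype.ext (Subtype.ext h)
    have hUfin : (Subtype.val '' U).Finite := Set.toFinite _
    let S : Finset α := insert w (insert w' hUfin.toFinset)
    have hScard : S.card = U.ncard + 2 := by
      have h1 : hUfin.toFinset.card = U.ncard := by
        rw [← Set.ncard_eq_toFinset_card _ hUfin, Set.ncard_image_of_injective _ Subtype.val_injective]
      rw [Finset.card_insert_of_notMem, Finset.card_insert_of_notMem, h1]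
      · rw [Set.Finite.mem_toFinset]
        rintro ⟨x, -, hx⟩
        exact x.2.2.2 hx
      · rw [Finset.mem_insert, Set.Finite.mem_toFinset]
        rintro (h | ⟨x, -, hx⟩)
        · exact hbl.ne h
        · exact x.2.2.1 hx
    let ι := {c : A.coe.ConnectedComponent // c ∈ A.coe.oddComponents}
    have : Fintype ι := Fintype.ofFinite _
    have hKfin : ∀ c : ι, (val2 '' c.1.supp).Finite := fun c ↦ Set.toFinite _
    have hcount := hG.three_mul_card_add_two_le hfin hb (ι := ι) S ?_ hbl (by simp [S])
      (by simp [S]) (fun c ↦ (hKfin c).toFinset) ?_ ?_ ?_ ?_ ?_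
    · have hq : Fintype.card ι = A.coe.oddComponents.ncard := by
        rw [← Nat.card_eq_fintype_card, ← Nat.card_coe_set_eq]
      have hviol : U.ncard < A.coe.oddComponents.ncard := hU
      have hpar := SimpleGraph.odd_ncard_oddComponents A.coe
      have hA : Nat.card A.verts + U.ncard = Nat.card W := by
        rw [Nat.card_coe_set_eq, ← Set.ncard_univ]
        exact Set.ncard_sdiff_add_ncard_of_subset (Set.subset_univ U)
      have hev := hG.even_ncard_vertexSet hfin
      rw [Nat.odd_iff, Nat.odd_iff] at hpar
      rw [Nat.even_iff] at hev
      omega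
    · intro x hx
      simp only [S, Finset.coe_insert, Set.Finite.coe_toFinset, Set.mem_insert_iff] at hx
      rcases hx with rfl | rfl | ⟨y, -, rfl⟩
      exacts [hbl.left_mem, hbl.right_mem, y.2.1]
    · intro c x hx
      rw [Set.Finite.coe_toFinset] at hx
      obtain ⟨y, -, rfl⟩ := hx
      exact y.1.2.1
    · intro c
      rw [← Set.ncard_eq_toFinset_card _ (hKfin c), Set.ncard_image_of_injective _ hval2]
      exact c.2
    · intro c x hx hxS
      rw [Set.Finite.mem_toFinset] at hx
      obtain ⟨y, -, rfl⟩ := hx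
      simp only [S, Finset.mem_insert, Set.Finite.mem_toFinset] at hxS
      rcases hxS with h | h | ⟨z, hz, h⟩
      · exact y.1.2.2.1 h
      · exact y.1.2.2.2 h
      · have hzy : z = y.1 := Subtype.ext h
        exact y.2.2 (hzy ▸ hz)
    · intro c d x hxc hxd
      rw [Set.Finite.mem_toFinset] at hxc hxd
      obtain ⟨y, hy, rfl⟩ := hxc
      obtain ⟨z, hz, h⟩ := hxd
      obtain rfl := hval2 h
      rw [SimpleGraph.ConnectedComponent.mem_supp_iff] at hy hz
      exact Subtype.ext (hy.symm.trans hz)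
    · intro c e x y hxy hx hyS
      rw [Set.Finite.mem_toFinset] at hx ⊢
      obtain ⟨x, hx, rfl⟩ := hx
      simp only [S, Finset.mem_insert, Set.Finite.mem_toFinset, not_or] at hyS
      let y' : W := ⟨y, hxy.right_mem, hyS.1, hyS.2.1⟩
      have hyU : y' ∉ U := fun h ↦ hyS.2.2 ⟨y', h, rfl⟩
      let y'' : A.verts := ⟨y', ⟨Set.mem_univ _, hyU⟩⟩
      refine ⟨y'', ?_, rfl⟩
      have hH : H.Adj x.1 y' := hxy.adj
      have hadj : A.coe.Adj x y'' := by
        simp only [A, SimpleGraph.Subgraph.coe_adj, SimpleGraph.Subgraph.deleteVerts_adj]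
        exact ⟨Set.mem_univ _, x.2.2, Set.mem_univ _, hyU, hH⟩
      rw [SimpleGraph.ConnectedComponent.mem_supp_iff] at hx ⊢
      rw [← hx]
      exact (SimpleGraph.ConnectedComponent.connectedComponentMk_eq_of_adj hadj).symm
  -- one edge of `G` for each edge of `H`; taking it on unordered pairs avoids parallel edges
  have hg : ∀ s : Sym2 W, ∃ e : β, ∀ x y, s = s(x, y) → H.Adj x y → G.IsLink e x y := by
    intro s
    induction s with | h x y =>
    by_cases h : H.Adj x y
    · obtain ⟨e, he⟩ := h
      refine ⟨e, fun x' y' hs _ ↦ ?_⟩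
      rcases Sym2.eq_iff.1 hs with ⟨rfl, rfl⟩ | ⟨rfl, rfl⟩
      exacts [he, he.symm]
    · refine ⟨b, fun x' y' hs hadj ↦ absurd ?_ h⟩
      rcases Sym2.eq_iff.1 hs with ⟨rfl, rfl⟩ | ⟨rfl, rfl⟩
      exacts [hadj, hadj.symm]
  choose g hg using hg
  have hgl : ∀ x y, N.Adj x y → G.IsLink (g s(x, y)) x y :=
    fun x y h ↦ hg _ x y rfl (N.adj_sub h)
  refine ⟨insert b {e | ∃ x y, N.Adj x y ∧ e = g s(x, y)}, ⟨?_, ?_⟩, Set.mem_insert _ _⟩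
  · rintro e (rfl | ⟨x, y, h, rfl⟩)
    exacts [hbE, (hgl x y h).edge_mem]
  · intro x hx
    by_cases hxw : x = w ∨ x = w'
    · refine ⟨b, ⟨Set.mem_insert _ _, ?_⟩, ?_⟩
      · rcases hxw with rfl | rfl
        exacts [hbl.inc_left, hbl.inc_right]
      · rintro e ⟨rfl | ⟨y, z, h, rfl⟩, hi⟩
        · rfl
        · exfalso
          have hy := y.2.2
          have hz := z.2.2
          rcases hi.eq_or_eq_of_isLink (hgl y z h) with rfl | rfl
          · rcases hxw with h | h
            exacts [hy.1 h, hy.2 h]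
          · rcases hxw with h | h
            exacts [hz.1 h, hz.2 h]
    · rw [not_or] at hxw
      let x' : W := ⟨x, hx, hxw⟩
      obtain ⟨y, hy, huniq⟩ := hN.1 (hN.2 x')
      refine ⟨g s(x', y), ⟨Or.inr ⟨x', y, hy, rfl⟩, (hgl x' y hy).inc_left⟩, ?_⟩
      rintro e ⟨rfl | ⟨u, v, h, rfl⟩, hi⟩
      · rcases hi.eq_or_eq_of_isLink hbl with h | h
        exacts [absurd h hxw.1, absurd h hxw.2]
      · rcases hi.eq_or_eq_of_isLink (hgl u v h) with hu | hv
        · obtain rfl : x' = u := Subtype.ext hu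
          rw [huniq v h]
        · obtain rfl : x' = v := Subtype.ext hv
          rw [huniq u h.symm, Sym2.eq_swap]

end

/-! ### Perfect matchings of the Petersen graph -/

/-- Exactly one of three Boolean values is true. -/
def exactlyOne (a b c : Bool) : Bool := (a && !b && !c) || (!a && b && !c) || (!a && !b && c)

set_option synthInstance.maxHeartbeats 400000 in
set_option synthInstance.maxSize 2000 in
set_option maxRecDepth 10000 in
/-- The six perfect matchings of the Petersen graph. The variables `oᵢ`, `sᵢ`, `qᵢ` say whether the
outer edge from `i` to `i + 1`, the spoke at `i` and the inner edge from `i` to `i + 2` belong to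
the matching. -/
theorem petersen_matchings_bool :
    ∀ o0 o4 s0, exactlyOne o0 o4 s0 →
    ∀ o1 s1, exactlyOne o1 o0 s1 →
    ∀ o2 s2, exactlyOne o2 o1 s2 →
    ∀ o3 s3, exactlyOne o3 o2 s3 →
    ∀ s4, exactlyOne o4 o3 s4 →
    ∀ q0 q3, exactlyOne q0 q3 s0 →
    ∀ q2, exactlyOne q2 q0 s2 →
    ∀ q4, exactlyOne q4 q2 s4 →
    ∀ q1, exactlyOne q1 q4 s1 → exactlyOne q3 q1 s3 →
    (s0 && s1 && s2 && s3 && s4) = true ∨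
    (s0 && o1 && o3 && q2 && q1) = true ∨
    (s1 && o2 && o4 && q3 && q2) = true ∨
    (s2 && o3 && o0 && q4 && q3) = true ∨
    (s3 && o4 && o1 && q0 && q4) = true ∨
    (s4 && o0 && o2 && q1 && q0) = true := by decide

/-- The perfect matching of the Petersen graph that consists of the five spokes, as the map that
sends each vertex to its partner. -/
def spokeMatching : ZMod 5 ⊕ ZMod 5 → ZMod 5 ⊕ ZMod 5
  | Sum.inl j => Sum.inr j
  | Sum.inr j => Sum.inl j

/-- The perfect matching of the Petersen graph whose only spoke is the one at `i`, as the map that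
sends each vertex to its partner. -/
def oneSpokeMatching (i : ZMod 5) : ZMod 5 ⊕ ZMod 5 → ZMod 5 ⊕ ZMod 5
  | Sum.inl j => if j = i then Sum.inr j else
      if j = i + 1 ∨ j = i + 3 then Sum.inl (j + 1) else Sum.inl (j - 1)
  | Sum.inr j => if j = i then Sum.inl j else
      if j = i + 1 ∨ j = i + 2 then Sum.inr (j + 2) else Sum.inr (j - 2)

/-- Every edge outside the matching `m` lies on a 5-cycle outside `m`. -/
def HasFiveCycles (m : ZMod 5 ⊕ ZMod 5 → ZMod 5 ⊕ ZMod 5) : Prop :=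
  ∀ u v, petersenAdj u v → v ≠ m u → ∃ x, petersenAdj v x ∧ x ≠ m v ∧ x ≠ u ∧
    ∃ y, petersenAdj x y ∧ y ≠ m x ∧ y ≠ v ∧ y ≠ u ∧
      ∃ z, petersenAdj y z ∧ z ≠ m y ∧ z ≠ x ∧ z ≠ v ∧
      petersenAdj z u ∧ u ≠ m z

set_option synthInstance.maxHeartbeats 400000 in
set_option synthInstance.maxSize 2000 in
instance (m : ZMod 5 ⊕ ZMod 5 → ZMod 5 ⊕ ZMod 5) : Decidable (HasFiveCycles m) := by
  unfold HasFiveCycles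
  infer_instance

set_option maxRecDepth 10000 in
lemma hasFiveCycles_spokeMatching : HasFiveCycles spokeMatching := by decide +kernel

set_option maxRecDepth 10000 in
lemma hasFiveCycles_oneSpokeMatching : ∀ i, HasFiveCycles (oneSpokeMatching i) := by
  decide +kernel

section
variable {p : Sym2 (ZMod 5 ⊕ ZMod 5) → Prop}

lemma exactlyOne_of_existsUnique [DecidablePred p]
    (hp : ∀ x, ∃! y, petersenAdj x y ∧ p s(x, y)) (x a b c : ZMod 5 ⊕ ZMod 5)
    (hadj : petersenAdj x a ∧ petersenAdj x b ∧ petersenAdj x c) (hab : a ≠ b) (hac : a ≠ c)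
    (hbc : b ≠ c) (hall : ∀ y, petersenAdj x y → y = a ∨ y = b ∨ y = c) :
    exactlyOne (p s(x, a)) (p s(x, b)) (p s(x, c)) = true := by
  obtain ⟨y, ⟨hy, hpy⟩, huniq⟩ := hp x
  have h : ∀ z, petersenAdj x z → (p s(x, z) ↔ z = y) :=
    fun z hz ↦ ⟨fun h ↦ huniq z ⟨hz, h⟩, fun h ↦ h ▸ hpy⟩
  simp only [h a hadj.1, h b hadj.2.1, h c hadj.2.2]
  rcases hall y hy with rfl | rfl | rfl <;> simp [exactlyOne, *, Ne.symm]

/-- A perfect matching of the Petersen graph is one of the six listed ones. -/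
lemma petersen_matching_eq (hp : ∀ x, ∃! y, petersenAdj x y ∧ p s(x, y)) :
    (∀ x, p s(x, spokeMatching x)) ∨ ∃ i, ∀ x, p s(x, oneSpokeMatching i x) := by
  classical
  have key := exactlyOne_of_existsUnique hp
  have sw : ∀ a b : ZMod 5 ⊕ ZMod 5, s(a, b) = s(b, a) := fun _ _ ↦ Sym2.eq_swap
  have h := petersen_matchings_bool
    (p s(Sum.inl 0, Sum.inl 1)) (p s(Sum.inl 0, Sum.inl 4)) (p s(Sum.inl 0, Sum.inr 0))
    (key _ _ _ _ (by decide) (by decide) (by decide) (by decide) (by decide))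
    (p s(Sum.inl 1, Sum.inl 2)) (p s(Sum.inl 1, Sum.inr 1))
    (by rw [sw (Sum.inl 0)]
        exact key _ _ _ _ (by decide) (by decide) (by decide) (by decide) (by decide))
    (p s(Sum.inl 2, Sum.inl 3)) (p s(Sum.inl 2, Sum.inr 2))
    (by rw [sw (Sum.inl 1)]
        exact key _ _ _ _ (by decide) (by decide) (by decide) (by decide) (by decide))
    (p s(Sum.inl 3, Sum.inl 4)) (p s(Sum.inl 3, Sum.inr 3))
    (by rw [sw (Sum.inl 2)]
        exact key _ _ _ _ (by decide) (by decide) (by decide) (by decide) (by decide))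
    (p s(Sum.inl 4, Sum.inr 4))
    (by rw [sw (Sum.inl 0), sw (Sum.inl 3)]
        exact key _ _ _ _ (by decide) (by decide) (by decide) (by decide) (by decide))
    (p s(Sum.inr 0, Sum.inr 2)) (p s(Sum.inr 0, Sum.inr 3))
    (by rw [sw (Sum.inl 0)]
        exact key _ _ _ _ (by decide) (by decide) (by decide) (by decide) (by decide))
    (p s(Sum.inr 2, Sum.inr 4))
    (by rw [sw (Sum.inr 0), sw (Sum.inl 2)]
        exact key _ _ _ _ (by decide) (by decide) (by decide) (by decide) (by decide))
    (p s(Sum.inr 4, Sum.inr 1))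
    (by rw [sw (Sum.inr 2), sw (Sum.inl 4)]
        exact key _ _ _ _ (by decide) (by decide) (by decide) (by decide) (by decide))
    (p s(Sum.inr 1, Sum.inr 3))
    (by rw [sw (Sum.inr 4), sw (Sum.inl 1)]
        exact key _ _ _ _ (by decide) (by decide) (by decide) (by decide) (by decide))
    (by rw [sw (Sum.inr 0), sw (Sum.inr 1), sw (Sum.inl 3)]
        exact key _ _ _ _ (by decide) (by decide) (by decide) (by decide) (by decide))
  simp only [Bool.and_eq_true, decide_eq_true_eq] at h
  have hcases : ∀ q : ZMod 5 ⊕ ZMod 5 → Prop, q (Sum.inl 0) → q (Sum.inl 1) → q (Sum.inl 2) →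
      q (Sum.inl 3) → q (Sum.inl 4) → q (Sum.inr 0) → q (Sum.inr 1) → q (Sum.inr 2) →
      q (Sum.inr 3) → q (Sum.inr 4) → ∀ x, q x := by
    intro q _ _ _ _ _ _ _ _ _ _ x
    rcases x with x | x <;> fin_cases x <;> assumption
  rcases h with h | h
  · obtain ⟨⟨⟨⟨h0, h1⟩, h2⟩, h3⟩, h4⟩ := h
    left
    apply hcases <;> first | assumption | (rw [sw]; assumption)
  · right
    rcases h with h | h | h | h | h <;> obtain ⟨⟨⟨⟨h0, h1⟩, h2⟩, h3⟩, h4⟩ := h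
    · refine ⟨0, ?_⟩
      apply hcases <;> first | assumption | (rw [sw]; assumption)
    · refine ⟨1, ?_⟩
      apply hcases <;> first | assumption | (rw [sw]; assumption)
    · refine ⟨2, ?_⟩
      apply hcases <;> first | assumption | (rw [sw]; assumption)
    · refine ⟨3, ?_⟩
      apply hcases <;> first | assumption | (rw [sw]; assumption)
    · refine ⟨4, ?_⟩
      apply hcases <;> first | assumption | (rw [sw]; assumption)

/-- The complement of a perfect matching of the Petersen graph consists of two 5-cycles. -/
lemma exists_fiveCycle (hp : ∀ x, ∃! y, petersenAdj x y ∧ p s(x, y)) {u v : ZMod 5 ⊕ ZMod 5}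
    (huv : petersenAdj u v) (hn : ¬ p s(u, v)) :
    ∃ x y z, (petersenAdj v x ∧ petersenAdj x y ∧ petersenAdj y z ∧ petersenAdj z u) ∧
      (¬ p s(v, x) ∧ ¬ p s(x, y) ∧ ¬ p s(y, z) ∧ ¬ p s(z, u)) ∧
      (x ≠ u ∧ y ≠ v ∧ z ≠ x ∧ y ≠ u ∧ z ≠ v) := by
  have key : ∀ m : ZMod 5 ⊕ ZMod 5 → ZMod 5 ⊕ ZMod 5, HasFiveCycles m →
      (∀ x, petersenAdj x (m x)) → (∀ x, p s(x, m x)) →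
      ∃ x y z, (petersenAdj v x ∧ petersenAdj x y ∧ petersenAdj y z ∧ petersenAdj z u) ∧
      (¬ p s(v, x) ∧ ¬ p s(x, y) ∧ ¬ p s(y, z) ∧ ¬ p s(z, u)) ∧
      (x ≠ u ∧ y ≠ v ∧ z ≠ x ∧ y ≠ u ∧ z ≠ v) := by
    intro m hm hadj hpm
    have hnp : ∀ x y, petersenAdj x y → y ≠ m x → ¬ p s(x, y) := fun x y hxy hy hpy ↦
      hy ((hp x).unique ⟨hxy, hpy⟩ ⟨hadj x, hpm x⟩)
    obtain ⟨x, hvx, hx, hxu, y, hxy, hy, hyv, hyu, z, hyz, hz, hzx, hzv, hzu, hu⟩ :=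
      hm u v huv (fun h ↦ hn (h ▸ hpm u))
    exact ⟨x, y, z, ⟨hvx, hxy, hyz, hzu⟩,
      ⟨hnp _ _ hvx hx, hnp _ _ hxy hy, hnp _ _ hyz hz, hnp _ _ hzu hu⟩, hxu, hyv, hzx, hyu, hzv⟩
  rcases petersen_matching_eq hp with h | ⟨i, h⟩
  · exact key _ hasFiveCycles_spokeMatching (by decide) h
  · exact key _ (hasFiveCycles_oneSpokeMatching i)
      ((by decide : ∀ i x, petersenAdj x (oneSpokeMatching i x)) i) h

end

/-! ### Colorings of the Petersen graph -/

section
variable {α β : Type*} {G : Graph α β}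

/-- A `G`-coloring of the Petersen graph, given as a map `F` on pairs of vertices (of which only the
edges matter) together with a map `φ` on vertices such that `F` maps the edges at `x` bijectively
to the edges at `φ x`. -/
structure IsPetersenColoring (G : Graph α β) (F : Sym2 (ZMod 5 ⊕ ZMod 5) → β)
    (φ : ZMod 5 ⊕ ZMod 5 → α) : Prop where
  map_mem : ∀ x, φ x ∈ G.vertexSet
  inj : ∀ {x y z}, petersenAdj x y → petersenAdj x z → F s(x, y) = F s(x, z) → y = z
  inc : ∀ {x y}, petersenAdj x y → G.Inc (F s(x, y)) (φ x)
  surj : ∀ {x b}, G.Inc b (φ x) → ∃ y, petersenAdj x y ∧ F s(x, y) = b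

lemma petersen_inc {e : Sym2 (ZMod 5 ⊕ ZMod 5)} {x : ZMod 5 ⊕ ZMod 5} :
    petersen.Inc e x ↔ ∃ y, e = s(x, y) ∧ petersenAdj x y := by
  refine exists_congr fun y ↦ ?_
  change (e = s(x, y) ∧ e ∈ petersenSimple.edgeSet) ↔ _
  refine and_congr_right ?_
  rintro rfl
  rfl

lemma petersenAdj.symm {x y : ZMod 5 ⊕ ZMod 5} (h : petersenAdj x y) : petersenAdj y x :=
  petersenSimple.symm.symm _ _ h

lemma petersen_mem_edgeSet {x y : ZMod 5 ⊕ ZMod 5} :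
    s(x, y) ∈ petersen.edgeSet ↔ petersenAdj x y := Iff.rfl

lemma exists_isPetersenColoring {f : petersen.edgeSet → G.edgeSet}
    (hf : IsColoring G petersen f) :
    ∃ F φ, IsPetersenColoring G F φ ∧ ∀ e, F e.1 = f e := by
  classical
  have h0 : s((Sum.inl 0 : ZMod 5 ⊕ ZMod 5), Sum.inr 0) ∈ petersen.edgeSet :=
    petersen_mem_edgeSet.2 rfl
  choose φ hφ himg using fun x ↦ hf.image_eq x (Set.mem_univ x)
  let F : Sym2 (ZMod 5 ⊕ ZMod 5) → β := fun e ↦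
    f (if h : e ∈ petersen.edgeSet then ⟨e, h⟩ else ⟨_, h0⟩)
  have hF : ∀ e : petersen.edgeSet, F e.1 = f e := by
    rintro ⟨e, he⟩
    simp only [F, dif_pos he]
  refine ⟨F, φ, ⟨hφ, ?_, ?_, ?_⟩, hF⟩
  · intro x y z hxy hxz h
    by_contra hne
    have hne' : s(x, y) ≠ s(x, z) := fun h ↦ hne (Sym2.congr_right.1 h)
    refine hf.proper ⟨_, petersen_mem_edgeSet.2 hxy⟩ ⟨_, petersen_mem_edgeSet.2 hxz⟩
      (fun h ↦ hne' (Subtype.ext_iff.1 h))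
      ⟨x, petersen_inc.2 ⟨y, rfl, hxy⟩, petersen_inc.2 ⟨z, rfl, hxz⟩⟩ ?_
    rw [Subtype.ext_iff, ← hF, ← hF]
    exact h
  · intro x y hxy
    rw [hF ⟨_, petersen_mem_edgeSet.2 hxy⟩]
    exact (himg x).subset ⟨_, petersen_inc.2 ⟨y, rfl, hxy⟩, rfl⟩
  · intro x b hb
    obtain ⟨⟨e, he⟩, hex, hfe⟩ :=
      (himg x).symm.subset (show (⟨b, hb.edge_mem⟩ : G.edgeSet) ∈ _ from hb)
    obtain ⟨y, rfl, hxy⟩ := petersen_inc.1 hex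
    refine ⟨y, hxy, ?_⟩
    rw [hF ⟨_, he⟩, hfe]

/-- At each vertex of a cubic graph only two edges lie outside a perfect matching. -/
lemma IsPerfectMatching.eq_of_inc {M : Set β} (hM : G.IsPerfectMatching M) (hG : G.IsCubic)
    {x : α} {a b c : β} (ha : G.Inc a x) (hb : G.Inc b x) (hc : G.Inc c x) (haM : a ∉ M)
    (hbM : b ∉ M) (hcM : c ∉ M) (hab : a ≠ b) (hac : a ≠ c) : b = c := by
  by_contra hbc
  obtain ⟨e, ⟨heM, he⟩, -⟩ := hM.existsUnique x ha.vertex_mem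
  have h4 : ({e, a, b, c} : Set β).ncard ≤ 3 := by
    rw [← hG.ncard_incidenceSet x ha.vertex_mem]
    refine Set.ncard_le_ncard ?_ (hG.finite_incidenceSet ha.vertex_mem)
    rintro d (rfl | rfl | rfl | rfl) <;> assumption
  rw [Set.ncard_insert_of_notMem (by rintro (rfl | rfl | rfl) <;> contradiction),
    Set.ncard_insert_of_notMem (by rintro (rfl | rfl) <;> contradiction),
    Set.ncard_pair hbc] at h4
  omega

lemma IsPerfectMatching.eq_of_mem {M : Set β} (hM : G.IsPerfectMatching M) {x : α} {a b : β}
    (ha : G.Inc a x) (hb : G.Inc b x) (haM : a ∈ M) (hbM : b ∈ M) : a = b :=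
  (hM.existsUnique x ha.vertex_mem).unique ⟨haM, ha⟩ ⟨hbM, hb⟩

/-- The three edges at a vertex of a cubic graph, one of them given. -/
lemma IsCubic.exists_incidenceSet_eq (hG : G.IsCubic) {x : α} {a : β} (ha : G.Inc a x) :
    ∃ b c, a ≠ b ∧ a ≠ c ∧ b ≠ c ∧ G.Inc b x ∧ G.Inc c x ∧
      ∀ e, G.Inc e x → e = a ∨ e = b ∨ e = c := by
  have h3 := hG.ncard_incidenceSet x ha.vertex_mem
  have h2 : (G.incidenceSet x \ {a}).ncard = 2 := by
    rw [Set.ncard_sdiff_singleton_of_mem (show a ∈ G.incidenceSet x from ha), h3]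
  obtain ⟨b, c, hbc, h⟩ := Set.ncard_eq_two.1 h2
  have hb : b ∈ G.incidenceSet x \ {a} := by simp [h]
  have hc : c ∈ G.incidenceSet x \ {a} := by simp [h]
  refine ⟨b, c, Ne.symm hb.2, Ne.symm hc.2, hbc, hb.1, hc.1, fun e he ↦ ?_⟩
  by_cases hea : e = a
  · exact Or.inl hea
  · have : e ∈ G.incidenceSet x \ {a} := ⟨he, hea⟩
    rw [h] at this
    exact Or.inr this

variable {F : Sym2 (ZMod 5 ⊕ ZMod 5) → β} {φ : ZMod 5 ⊕ ZMod 5 → α}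

/-- Perfect matchings pull back along colorings. -/
lemma IsPetersenColoring.existsUnique_mem (hF : IsPetersenColoring G F φ) {M : Set β}
    (hM : G.IsPerfectMatching M) (x : ZMod 5 ⊕ ZMod 5) :
    ∃! y, petersenAdj x y ∧ F s(x, y) ∈ M := by
  obtain ⟨e, ⟨heM, he⟩, -⟩ := hM.existsUnique _ (hF.map_mem x)
  obtain ⟨y, hxy, rfl⟩ := hF.surj he
  exact ⟨y, ⟨hxy, heM⟩, fun z ⟨hxz, hzM⟩ ↦
    hF.inj hxz hxy (hM.eq_of_mem (hF.inc hxz) (hF.inc hxy) hzM heM)⟩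

lemma IsPetersenColoring.inc' (hF : IsPetersenColoring G F φ) {x y : ZMod 5 ⊕ ZMod 5}
    (h : petersenAdj x y) : G.Inc (F s(x, y)) (φ y) := by
  rw [Sym2.eq_swap]
  exact hF.inc h.symm

lemma IsPetersenColoring.ne (hF : IsPetersenColoring G F φ) {x y z : ZMod 5 ⊕ ZMod 5}
    (hxy : petersenAdj x y) (hyz : petersenAdj y z) (hxz : z ≠ x) : F s(x, y) ≠ F s(y, z) := by
  rw [Sym2.eq_swap]
  exact fun h ↦ hxz (hF.inj hxy.symm hyz h).symm

/-- A 5-cycle through `uv` that avoids the preimage of a perfect matching is mapped to a closed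
walk of five edges outside the matching, in which consecutive edges are distinct edges at a common
vertex. The edges are listed from the one after `uv` on. -/
lemma IsPetersenColoring.exists_closedWalk (hF : IsPetersenColoring G F φ) {M : Set β}
    (hM : G.IsPerfectMatching M) {u v : ZMod 5 ⊕ ZMod 5} (huv : petersenAdj u v)
    (hn : F s(u, v) ∉ M) :
    ∃ a₁ a₂ a₃ a₄ w₂ w₃ w₄, (a₁ ∉ M ∧ a₂ ∉ M ∧ a₃ ∉ M ∧ a₄ ∉ M) ∧
      (F s(u, v) ≠ a₁ ∧ a₁ ≠ a₂ ∧ a₂ ≠ a₃ ∧ a₃ ≠ a₄ ∧ a₄ ≠ F s(u, v)) ∧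
      G.Inc a₁ (φ v) ∧ G.Inc a₁ w₂ ∧ G.Inc a₂ w₂ ∧ G.Inc a₂ w₃ ∧ G.Inc a₃ w₃ ∧ G.Inc a₃ w₄ ∧
      G.Inc a₄ w₄ ∧ G.Inc a₄ (φ u) := by
  obtain ⟨x, y, z, ⟨hvx, hxy, hyz, hzu⟩, ⟨h1, h2, h3, h4⟩, hxu, hyv, hzx, hyu, hzv⟩ :=
    exists_fiveCycle (p := fun e ↦ F e ∈ M) (hF.existsUnique_mem hM) huv hn
  exact ⟨_, _, _, _, φ x, φ y, φ z, ⟨h1, h2, h3, h4⟩,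
    ⟨hF.ne huv hvx hxu, hF.ne hvx hxy hyv, hF.ne hxy hyz hzx, hF.ne hyz hzu hyu.symm,
      hF.ne hzu huv hzv.symm⟩,
    hF.inc hvx, hF.inc' hvx, hF.inc hxy, hF.inc' hxy, hF.inc hyz, hF.inc' hyz, hF.inc hzu,
    hF.inc' hzu⟩

lemma IsLink.of_inc_of_inc {e : β} {x y : α} (hx : G.Inc e x) (hy : G.Inc e y) (hne : x ≠ y) :
    G.IsLink e x y := by
  obtain ⟨z, hz⟩ := hx
  rcases hy.eq_or_eq_of_isLink hz with rfl | rfl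
  · exact absurd rfl hne
  · exact hz

/-- If both ends of `uv` are mapped to the same vertex `w`, then the closed walk of length five
traverses `F uv` at the same vertex twice, so without it the walk has only three distinct edges,
which form a triangle containing `F uv`. -/
lemma IsPetersenColoring.exists_triangle (hF : IsPetersenColoring G F φ) (hG : G.IsCubic)
    {M : Set β} (hM : G.IsPerfectMatching M) {u v : ZMod 5 ⊕ ZMod 5} (huv : petersenAdj u v)
    (hn : F s(u, v) ∉ M) (hφ : φ u = φ v) :
    ∃ y z c d, G.IsLink (F s(u, v)) (φ u) y ∧ G.IsLink c (φ u) z ∧ G.IsLink d y z ∧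
      c ∉ M ∧ d ∉ M := by
  obtain ⟨a₁, a₂, a₃, a₄, w₂, w₃, w₄, ⟨h1, h2, h3, h4⟩, ⟨n1, n2, n3, n4, n5⟩, i1, i2, i3, i4, i5,
    i6, i7, i8⟩ := hF.exists_closedWalk hM huv hn
  rw [← hφ] at i1
  have i0 := hF.inc huv
  have h14 : a₁ = a₄ := hM.eq_of_inc hG i0 i1 i8 hn h1 h4 n1 n5.symm
  subst h14
  have h24 : w₂ ≠ w₄ := fun h ↦ n3 (hM.eq_of_inc hG i2 i3 (h ▸ i6) h1 h2 h3 n2 n4.symm)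
  have h23 : w₂ ≠ w₃ := fun h ↦ n4 (hM.eq_of_inc hG i3 (h ▸ i5) i2 h2 h3 h1 n3 n2.symm)
  have h34 : w₃ ≠ w₄ := fun h ↦ n2 (hM.eq_of_inc hG i6 i7 (h ▸ i4) h3 h1 h2 n4 n3.symm)
  have l1 := IsLink.of_inc_of_inc i2 i7 h24
  rcases i1.eq_or_eq_of_isLink l1 with h | h
  · have h02 : F s(u, v) = a₂ := hM.eq_of_inc hG i1 i0 (h ▸ i3) h1 hn h2 n1.symm n2
    refine ⟨w₃, w₄, a₁, a₃, ?_, h ▸ l1, IsLink.of_inc_of_inc i5 i6 h34, h1, h3⟩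
    rw [h02, h]
    exact IsLink.of_inc_of_inc i3 i4 h23
  · have h03 : F s(u, v) = a₃ := hM.eq_of_inc hG i1 i0 (h ▸ i6) h1 hn h3 n1.symm n4.symm
    refine ⟨w₃, w₂, a₁, a₂, ?_, h ▸ l1.symm, IsLink.of_inc_of_inc i4 i3 h23.symm, h1, h2⟩
    rw [h03, h]
    exact (IsLink.of_inc_of_inc i5 i6 h34).symm

/-- The ends of an edge are mapped to distinct vertices. Otherwise let `a` be the image of the edge,
at `w`, and `b`, `c` the other edges at `w`. A perfect matching through `b` yields a triangle `a, c, d`,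
and one through `c` yields a triangle `a, b, d'`. If `d = d'`, a perfect matching through `d` cannot
cover `w`; otherwise the matching through `b` must also contain `d'`, which meets `b`. -/
lemma IsPetersenColoring.map_ne (hF : IsPetersenColoring G F φ) (hG : G.IsCubic)
    (hfin : G.vertexSet.Finite) (hb : G.IsBridgeless) {u v : ZMod 5 ⊕ ZMod 5}
    (huv : petersenAdj u v) : φ u ≠ φ v := by
  intro hφ
  have hl := hG.loopless
  have ha := hF.inc huv
  obtain ⟨b, c, hab, hac, hbc, hbi, hci, hall⟩ := hG.exists_incidenceSet_eq ha
  obtain ⟨M, hM, hbM⟩ := hG.exists_isPerfectMatching hfin hb hbi.edge_mem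
  obtain ⟨M', hM', hcM'⟩ := hG.exists_isPerfectMatching hfin hb hci.edge_mem
  have haM : F s(u, v) ∉ M := fun h ↦ hab (hM.eq_of_mem ha hbi h hbM)
  have haM' : F s(u, v) ∉ M' := fun h ↦ hac (hM'.eq_of_mem ha hci h hcM')
  obtain ⟨y, z, c₁, d, hay, hcz, hd, hc₁M, hdM⟩ := hF.exists_triangle hG hM huv haM hφ
  obtain ⟨y', z', b₁, d', hay', hbz, hd', hb₁M, hdM'⟩ := hF.exists_triangle hG hM' huv haM' hφ
  obtain rfl := hay.right_unique hay'
  have hane : ∀ {e x}, G.IsLink e y x → ∀ {g t}, G.IsLink g (φ u) t → t = x →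
      F s(u, v) ≠ g ∧ F s(u, v) ≠ e := by
    rintro e x he g t hg rfl
    constructor
    · rintro rfl
      exact he.ne (hay.right_unique hg)
    · rintro rfl
      exact hg.ne (hay.symm.right_unique he)
  obtain ⟨hac₁, had⟩ := hane hd hcz rfl
  obtain ⟨hab₁, had'⟩ := hane hd' hbz rfl
  obtain rfl : c₁ = c := by
    rcases hall c₁ hcz.inc_left with h | h | h
    · exact absurd h.symm hac₁
    · exact absurd (h ▸ hbM) hc₁M
    · exact h
  obtain rfl : b₁ = b := by
    rcases hall b₁ hbz.inc_left with h | h | h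
    · exact absurd h.symm hab₁
    · exact h
    · exact absurd (h ▸ hcM') hb₁M
  by_cases hdd : d = d'
  · -- a perfect matching through `d` has no edge left at `φ u`
    subst hdd
    obtain rfl := hd.right_unique hd'
    obtain ⟨M'', hM'', hdM''⟩ := hG.exists_isPerfectMatching hfin hb hd.edge_mem
    obtain ⟨e, ⟨heM, he⟩, -⟩ := hM''.existsUnique _ ha.vertex_mem
    have hed : e = d := by
      rcases hall e he with rfl | rfl | rfl
      · exact hM''.eq_of_mem hay.inc_right hd.inc_left heM hdM''
      · exact hM''.eq_of_mem hbz.inc_right hd.inc_right heM hdM''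
      · exact hM''.eq_of_mem hcz.inc_right hd.inc_right heM hdM''
    subst hed
    rcases he.eq_or_eq_of_isLink hd with h | h
    · exact hay.ne h
    · exact hcz.ne h
  · -- `M` covers `y` by `d'`, which meets `b` in `z'`
    have hd'M : d' ∈ M := by
      by_contra h
      exact hdd (hM.eq_of_inc hG hay.inc_right hd.inc_left hd'.inc_left haM hdM h had had')
    have hbd : b₁ = d' := hM.eq_of_mem hbz.inc_right hd'.inc_right hbM hd'M
    subst hbd
    rcases hbi.eq_or_eq_of_isLink hd' with h | h
    · exact hay.ne h
    · exact hbz.ne h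

/-- Two vertices with the same image have a common neighbour, which yields parallel edges `a`, `b`
of `G`. Around a 5-cycle outside the preimage of a perfect matching through the third edge at an end
of `a` and `b`, these two colors would alternate. -/
lemma IsPetersenColoring.injective (hF : IsPetersenColoring G F φ) (hG : G.IsCubic)
    (hfin : G.vertexSet.Finite) (hb : G.IsBridgeless) : Function.Injective φ := by
  intro x y hxy
  by_contra hne
  have hdiam : ∀ x y : ZMod 5 ⊕ ZMod 5, x ≠ y → ¬ petersenAdj x y →
      ∃ z, petersenAdj z x ∧ petersenAdj z y := by decide
  obtain ⟨z, hzx, hzy⟩ := hdiam x y hne fun h ↦ hF.map_ne hG hfin hb h hxy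
  have hne' : F s(z, x) ≠ F s(z, y) := fun h ↦ hne (hF.inj hzx hzy h)
  have hz := hF.map_ne hG hfin hb hzx
  have la := IsLink.of_inc_of_inc (hF.inc hzx) (hF.inc' hzx) hz
  have lb := IsLink.of_inc_of_inc (hF.inc hzy) (hxy ▸ hF.inc' hzy) hz
  obtain ⟨c, hc, hca, hcb⟩ : ∃ c, G.Inc c (φ z) ∧ c ≠ F s(z, x) ∧ c ≠ F s(z, y) := by
    obtain ⟨b, c, hab, hac, hbc, hbi, hci, -⟩ := hG.exists_incidenceSet_eq la.inc_left
    by_cases h : b = F s(z, y)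
    · exact ⟨c, hci, hac.symm, fun h' ↦ hbc (h.trans h'.symm)⟩
    · exact ⟨b, hbi, hab.symm, h⟩
  obtain ⟨M, hM, hcM⟩ := hG.exists_isPerfectMatching hfin hb hc.edge_mem
  have haM : F s(z, x) ∉ M := fun h ↦ hca (hM.eq_of_mem hc la.inc_left hcM h)
  have hbM : F s(z, y) ∉ M := fun h ↦ hcb (hM.eq_of_mem hc lb.inc_left hcM h)
  obtain ⟨a₁, a₂, a₃, a₄, w₂, w₃, w₄, ⟨h1, h2, h3, h4⟩, ⟨n1, n2, n3, n4, n5⟩, i1, i2, i3, i4, i5,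
    i6, i7, i8⟩ := hF.exists_closedWalk hM hzx haM
  -- a step of the walk from `a` leads to `b`, and conversely
  have step : ∀ {e t}, G.Inc e t → e ∉ M →
      (G.Inc (F s(z, x)) t → F s(z, x) ≠ e → e = F s(z, y)) ∧
      (G.Inc (F s(z, y)) t → F s(z, y) ≠ e → e = F s(z, x)) := by
    intro e t he heM
    constructor <;> intro ht hte
    · have ht' : G.Inc (F s(z, y)) t := by
        rcases ht.eq_or_eq_of_isLink la with rfl | rfl
        exacts [lb.inc_left, lb.inc_right]
      exact (hM.eq_of_inc hG ht ht' he haM hbM heM hne' hte).symm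
    · have ht' : G.Inc (F s(z, x)) t := by
        rcases ht.eq_or_eq_of_isLink lb with rfl | rfl
        exacts [la.inc_left, la.inc_right]
      exact (hM.eq_of_inc hG ht ht' he hbM haM heM hne'.symm hte).symm
  have e1 := (step i1 h1).1 la.inc_right n1
  subst e1
  have e2 := (step i3 h2).2 i2 n2
  subst e2
  have e3 := (step i5 h3).1 i4 n3
  subst e3
  exact n5 ((step i7 h4).2 i6 n4)

end
end Graph

/-! ### The isomorphism -/

open Graph in
theorem theorem1 {α β : Type*} (G : Graph α β) (hfin : G.vertexSet.Finite)
    (hcubic : G.IsCubic) (hconn : G.IsConnected) (hbridge : G.IsBridgeless)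
    (hprec : Graph.Prec G Graph.petersen) :
    Graph.IsIsomorphic G Graph.petersen := by
  obtain ⟨f, hf⟩ := hprec
  obtain ⟨F, φ, hF, hFf⟩ := exists_isPetersenColoring hf
  have hinj := hF.injective hcubic hfin hbridge
  have hne : ∀ {x y}, petersenAdj x y → φ x ≠ φ y := hF.map_ne hcubic hfin hbridge
  have hlink : ∀ {x y}, petersenAdj x y → G.IsLink (F s(x, y)) (φ x) (φ y) := fun h ↦
    IsLink.of_inc_of_inc (hF.inc h) (hF.inc' h) (hne h)
  -- the image of `φ` is closed under adjacency
  have hsurj : ∀ w ∈ G.vertexSet, ∃ x, φ x = w := by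
    intro w hw
    have h := (hconn.reachable _ (hF.map_mem (Sum.inl 0)) w hw).2
    induction h with
    | refl => exact ⟨_, rfl⟩
    | tail _ hab ih =>
      obtain ⟨e, he⟩ := hab
      obtain ⟨x, rfl⟩ := ih he.left_mem
      obtain ⟨y, hxy, rfl⟩ := hF.surj he.inc_left
      exact ⟨y, (hlink hxy).right_unique he⟩
  have hφbij : Function.Bijective (fun x : petersen.vertexSet ↦
      (⟨φ x.1, hF.map_mem x.1⟩ : G.vertexSet)) := by
    refine ⟨fun x y h ↦ Subtype.ext (hinj (Subtype.ext_iff.1 h)), fun ⟨w, hw⟩ ↦ ?_⟩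
    obtain ⟨x, hx⟩ := hsurj w hw
    exact ⟨⟨x, Set.mem_univ x⟩, Subtype.ext hx⟩
  have hfbij : Function.Bijective f := by
    constructor
    · rintro ⟨e, he⟩ ⟨e', he'⟩ h
      rw [Subtype.ext_iff, ← hFf, ← hFf] at h
      induction e with | h x y =>
      induction e' with | h x' y' =>
      have hl := hlink (petersen_mem_edgeSet.1 he)
      have hl' := hlink (petersen_mem_edgeSet.1 he')
      rw [h] at hl
      refine Subtype.ext (Sym2.eq_iff.2 ?_)
      exact (hl.eq_and_eq_or_eq_and_eq hl').imp (And.imp (@hinj _ _) (@hinj _ _))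
        (And.imp (@hinj _ _) (@hinj _ _))
    · rintro ⟨e, he⟩
      obtain ⟨w, w', hww'⟩ := exists_isLink_of_mem_edgeSet he
      obtain ⟨x, rfl⟩ := hsurj w hww'.left_mem
      obtain ⟨y, hxy, rfl⟩ := hF.surj hww'.inc_left
      exact ⟨⟨_, petersen_mem_edgeSet.2 hxy⟩, Subtype.ext (hFf _).symm⟩
  refine ⟨(Equiv.ofBijective _ hφbij).symm, (Equiv.ofBijective f hfbij).symm, fun e x y ↦ ?_⟩
  obtain ⟨e, rfl⟩ := (Equiv.ofBijective f hfbij).surjective e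
  obtain ⟨x, rfl⟩ := (Equiv.ofBijective _ hφbij).surjective x
  obtain ⟨y, rfl⟩ := (Equiv.ofBijective _ hφbij).surjective y
  rw [Equiv.symm_apply_apply, Equiv.symm_apply_apply, Equiv.symm_apply_apply]
  obtain ⟨e, he⟩ := e
  obtain ⟨x, -⟩ := x
  obtain ⟨y, -⟩ := y
  simp only [Equiv.ofBijective_apply]
  rw [← hFf]
  constructor
  · intro h
    induction e with | h u v =>
    have huv := petersen_mem_edgeSet.1 he
    refine ⟨?_, he⟩
    exact Sym2.eq_iff.2 (((hlink huv).eq_and_eq_or_eq_and_eq h).imp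
      (And.imp (@hinj _ _) (@hinj _ _)) (And.imp (@hinj _ _) (@hinj _ _)))
  · rintro ⟨rfl, -⟩
    exact hlink (petersen_mem_edgeSet.1 he)
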